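/- Let $M\ge 2$ be an integer, let $p$ be a prime divisor of $M$, and let $n\ge 1$ be such that $p^{n}\mid M$ and $p^{n+1}\nmid M$. Write $\mathbb{Z}_M=\mathbb{Z}/M\mathbb{Z}$ and use the following notation. For $N\ge 1$ and $A\subset\mathbb{Z}_N$ let $A(X)=\sum_{a\in A}X^a\in\mathbb{Z}[X]$, with $\mathbb{Z}_N$ represented by $\{0,1,\dots,N-1\}$, and for $A,B\subset\mathbb{Z}_N$ write $A\oplus B=\mathbb{Z}_N$ if $A(X)B(X)\equiv 1+X+\dots+X^{N-1} \pmod{X^N-1}$ (that is, every element of $\mathbb{Z}_N$ is $a+b$ for exactly one pair $(a,b)\in A\times B$). If $N\mid M$ and $A,B\subset\mathbb{Z}_M$, then $A\oplus B=\mathbb{Z}_N$ means that no two distinct elements of $A$, and no two distinct elements of $B$, are congruent mod $N$, and that the reductions of $A$ and $B$ mod $N$ satisfy this condition. Let $\Phi_s$ be the $s$-th cyclotomic polynomial; $\Phi_s\mid A$ means that $\Phi_s(X)$ divides $A(X)$. For $A\subset\mathbb{Z}_M$ let $\mathrm{Div}(A)=\{\gcd(a-a',M):\ a,a'\in A\}$.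 For each prime $q\mid M$ with $q^{k}\mid M$, $q^{k+1}\nmid M$, put $M_q=M/q^{k}$; every $x\in\mathbb{Z}_M$ can be written uniquely as $x=\sum_{q\mid M}\pi_q(x)M_q$ with $\pi_q(x)\in\{0,1,\dots,q^{k}-1\}$. For $A\subset\mathbb{Z}_M$ define the slab $A_{p}=\{a\in A:\ 0\le\pi_p(a)\le p^{n-1}-1\}$. **Theorem.** Let $A,B\subset\mathbb{Z}_M$ with $A\oplus B=\mathbb{Z}_M$ and $\Phi_{p^{n}}\mid A$. Then the following are equivalent. (i) For every translate $A'$ of $A$ we have $A'_{p}\oplus B=\mathbb{Z}_{M/p}$. (ii) For every $d$ with $p^{n}\mid d\mid M$, at least one of the following holds: $\Phi_d\mid A$, or $\Phi_{d/p}\Phi_{d/p^2}\cdots\Phi_{d/p^{n}}\mid B$. (iii) For every $m$ with $p^{n}\mid m\mid M$: if $m\in\mathrm{Div}(A)$ then $m/p\notin\mathrm{Div}(B)$. -/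

import Mathlib

/-- For `x ∈ ℤ_M` and a prime `p ∣ M` with `p ^ n ∥ M`, the array coordinate `π_p(x) ∈ ℤ_{p ^ n}`.
With `M_p = M / p ^ n` it is the class of `x * M_p⁻¹` modulo `p ^ n`; that these are exactly the
coefficients of the unique expansion `x = ∑_p π_p(x) M_p` is shown in `arrayCoord_expansion` and
`arrayCoord_unique`. -/
def arrayCoord {M : ℕ} (p : ℕ) (x : ZMod M) : ZMod (p ^ M.factorization p) :=
  (x.cast : ZMod (p ^ M.factorization p)) *
    ((M / p ^ M.factorization p : ℕ) : ZMod (p ^ M.factorization p))⁻¹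

theorem cast_expansion_eq {M : ℕ} (c : ℕ → ℕ) {p : ℕ} (hp : p ∈ M.primeFactors) :
    ((∑ q ∈ M.primeFactors, c q * (M / q ^ M.factorization q) : ℕ) :
        ZMod (p ^ M.factorization p)) =
      (c p : ZMod (p ^ M.factorization p)) *
        ((M / p ^ M.factorization p : ℕ) : ZMod (p ^ M.factorization p)) := by
  rw [← Finset.add_sum_erase _ _ hp]
  have h : (p ^ M.factorization p) ∣
      ∑ q ∈ M.primeFactors.erase p, c q * (M / q ^ M.factorization q) := by
    refine Finset.dvd_sum fun q hq => Dvd.dvd.mul_left ?_ _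
    obtain ⟨hqp, hq⟩ := Finset.mem_erase.1 hq
    have hco : Nat.Coprime (p ^ M.factorization p) (q ^ M.factorization q) :=
      Nat.Coprime.pow _ _ ((Nat.coprime_primes (Nat.prime_of_mem_primeFactors hp)
        (Nat.prime_of_mem_primeFactors hq)).2 hqp.symm)
    refine hco.dvd_of_dvd_mul_left ?_
    rw [Nat.mul_div_cancel' (Nat.ordProj_dvd M q)]
    exact Nat.ordProj_dvd M p
  rw [Nat.cast_add, (ZMod.natCast_eq_zero_iff _ _).2 h]
  push_cast
  ring

theorem arrayCoord_unit {M : ℕ} (hM : M ≠ 0) {p : ℕ} (hp : p ∈ M.primeFactors) :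
    ((M / p ^ M.factorization p : ℕ) : ZMod (p ^ M.factorization p)) *
      ((M / p ^ M.factorization p : ℕ) : ZMod (p ^ M.factorization p))⁻¹ = 1 :=
  ZMod.coe_mul_inv_eq_one _
    (Nat.Coprime.pow_left _ (Nat.coprime_ordCompl (Nat.prime_of_mem_primeFactors hp) hM)).symm

/-- `x = ∑_p π_p(x) M_p` in `ℤ_M`. -/
theorem arrayCoord_expansion {M : ℕ} (hM : M ≠ 0) (x : ZMod M) :
    x = ((∑ q ∈ M.primeFactors,
      (arrayCoord q x).val * (M / q ^ M.factorization q) : ℕ) : ZMod M) := by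
  have : NeZero M := ⟨hM⟩
  conv_lhs => rw [← ZMod.natCast_zmod_val x]
  rw [ZMod.natCast_eq_natCast_iff, Nat.modEq_iff_dvd, Int.natCast_dvd,
    Nat.dvd_iff_prime_pow_dvd_dvd]
  intro p k hp hk
  rcases Nat.eq_zero_or_pos k with rfl | hk0
  · simp
  have hpm : p ∈ M.primeFactors :=
    Nat.mem_primeFactors.2 ⟨hp, (dvd_pow_self p hk0.ne').trans hk, hM⟩
  have : NeZero (p ^ M.factorization p) := ⟨pow_ne_zero _ hp.ne_zero⟩
  refine (pow_dvd_pow p ((hp.pow_dvd_iff_le_factorization hM).1 hk)).trans ?_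
  rw [← Int.natCast_dvd, ← Nat.modEq_iff_dvd, ← ZMod.natCast_eq_natCast_iff,
    cast_expansion_eq _ hpm, ZMod.natCast_zmod_val, arrayCoord, mul_assoc,
    mul_comm (_⁻¹), arrayCoord_unit hM hpm, mul_one, ZMod.natCast_val]

/-- The coefficients in the expansion of `x` are unique. -/
theorem arrayCoord_unique {M : ℕ} (hM : M ≠ 0) (x : ZMod M) (c : ℕ → ℕ)
    (hc : ∀ q ∈ M.primeFactors, c q < q ^ M.factorization q)
    (hx : x = ((∑ q ∈ M.primeFactors, c q * (M / q ^ M.factorization q) : ℕ) : ZMod M))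
    {p : ℕ} (hp : p ∈ M.primeFactors) : (arrayCoord p x).val = c p := by
  have h : (x.cast : ZMod (p ^ M.factorization p)) =
      (c p : ZMod (p ^ M.factorization p)) *
        ((M / p ^ M.factorization p : ℕ) : ZMod (p ^ M.factorization p)) := by
    rw [← cast_expansion_eq c hp, hx, ZMod.cast_natCast (Nat.ordProj_dvd M p)]
  rw [arrayCoord, h, mul_assoc, arrayCoord_unit hM hp, mul_one, ZMod.val_natCast,
    Nat.mod_eq_of_lt (hc p hp)]

/-- The translate `t + A`. -/
def translateSet {M : ℕ} (t : ZMod M) (A : Finset (ZMod M)) : Finset (ZMod M) :=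
  A.image (fun a => t + a)

/-- The slab `A_p = {a ∈ A : 0 ≤ π_p(a) ≤ p ^ (n - 1) - 1}`, where `p ^ n ∥ M`. -/
def slab {M : ℕ} (p : ℕ) (A : Finset (ZMod M)) : Finset (ZMod M) :=
  A.filter (fun a => (arrayCoord p a).val ≤ p ^ (M.factorization p - 1) - 1)

/-- The mask polynomial `A(X) = ∑_{a ∈ A} X ^ a`, with `ℤ_M` represented by `0, …, M - 1`. -/
noncomputable def maskPoly {M : ℕ} (A : Finset (ZMod M)) : Polynomial ℤ :=
  ∑ a ∈ A, (Polynomial.X : Polynomial ℤ) ^ a.val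

/-- `A ⊕ B = ℤ_N`: `A(X) B(X) ≡ 1 + X + ⋯ + X ^ (N - 1)` modulo `X ^ N - 1`. -/
def IsTiling {N : ℕ} (A B : Finset (ZMod N)) : Prop :=
  ((Polynomial.X : Polynomial ℤ) ^ N - 1) ∣
    maskPoly A * maskPoly B - ∑ k ∈ Finset.range N, (Polynomial.X : Polynomial ℤ) ^ k

/-- `A ⊕ B = ℤ_N` for `A, B ⊆ ℤ_M` considered modulo a divisor `N` of `M`: the multisets induced
by `A` and `B` in `ℤ_N` are sets (no two elements of `A`, and no two of `B`, are congruent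
modulo `N`), and these sets tile `ℤ_N`. -/
def IsTilingMod {M : ℕ} (N : ℕ) (A B : Finset (ZMod M)) : Prop :=
  Set.InjOn (fun a : ZMod M => (a.cast : ZMod N)) (A : Set (ZMod M)) ∧
  Set.InjOn (fun b : ZMod M => (b.cast : ZMod N)) (B : Set (ZMod M)) ∧
  IsTiling (A.image (fun a => (a.cast : ZMod N))) (B.image (fun b => (b.cast : ZMod N)))

/-- The divisor set `Div(A) = {(a - a', M) : a, a' ∈ A}`. -/
def divSet {M : ℕ} (A : Finset (ZMod M)) : Set ℕ :=
  {m | ∃ a ∈ A, ∃ a' ∈ A, m = Nat.gcd (a - a').val M}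

/-! Everything is tested at roots of unity. Let `w` have order `p ^ j * e` with `j < n` and `p ∤ e`;
these are the orders dividing `M / p`. Grouping the terms of `A(w)` by the coordinate `π_p` gives a
function `F` on `ZMod (p ^ n)` (`fiberSum`). Twisting `F` by a primitive `p ^ n`-th root of unity
gives `A` at a root of order `d = p ^ n * e`, so Fourier inversion shows that `Φ_d ∣ A` iff `F` is
`p ^ (n - 1)`-periodic. Up to a factor `w ^ t`, the slabs of the translates evaluate at `w` to the
sums of `F` over windows of length `p ^ (n - 1)`.

(i) ⇔ (ii): if `B(w) ≠ 0` and `w ≠ 1`, then (i) makes all windows vanish, so `F` is periodic and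
`Φ_d ∣ A`. Conversely, periodicity gives each window the share `A(w) / p`, and `A(w) B(w) = 0`
passes to the slabs. At `w = 1` the hypothesis `Φ_{p ^ n} ∣ A` supplies the right cardinality.

(i) ⇔ (iii): by Sands's theorem (`IsTilingMod.eq_of_gcd_eq`), nontrivial differences from the two
factors never have the same gcd with the modulus. Passing from modulus `M` to `M / p` changes a gcd,
by a factor `p`, exactly when `p ^ n` divides the difference. Hence the only new coincidences are
those in (iii), or the reverse ones with `p ^ n` dividing only the difference from `B`, which a slab
excludes. -/

/-! ### Tilings, character sums and Sands's theorem -/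

section CharacterSums

open Polynomial

theorem pow_val_natCast {N : ℕ} {w : ℂ} (hw : w ^ N = 1) (k : ℕ) :
    w ^ (k : ZMod N).val = w ^ k := by
  rw [ZMod.val_natCast]
  exact pow_eq_pow_of_modEq (Nat.mod_modEq _ _) hw

theorem pow_val_add {N : ℕ} [NeZero N] {w : ℂ} (hw : w ^ N = 1) (x y : ZMod N) :
    w ^ (x + y).val = w ^ x.val * w ^ y.val := by
  rw [ZMod.val_add, ← pow_add]
  exact pow_eq_pow_of_modEq (Nat.mod_modEq _ _) hw

theorem pow_val_mul {N : ℕ} {w : ℂ} (hw : w ^ N = 1) (x y : ZMod N) :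
    w ^ (x * y).val = (w ^ x.val) ^ y.val := by
  rw [ZMod.val_mul, ← pow_mul]
  exact pow_eq_pow_of_modEq (Nat.mod_modEq _ _) hw

theorem pow_val_cast {M N : ℕ} [NeZero M] {w : ℂ} (hw : w ^ N = 1)
    (x : ZMod M) : w ^ (x.cast : ZMod N).val = w ^ x.val := by
  have : (x.cast : ZMod N) = ((x.val : ℕ) : ZMod N) := by
    rw [ZMod.natCast_val]
  rw [this, pow_val_natCast hw]

/-- A function on `ZMod N` is determined by its character sums. -/
theorem eq_zero_of_character_sums {N : ℕ} [NeZero N] (G : ZMod N → ℂ)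
    (h : ∀ w : ℂ, w ^ N = 1 → ∑ x, G x * w ^ x.val = 0) : G = 0 := by
  set P : ℂ[X] := ∑ x : ZMod N, C (G x) * X ^ x.val with hP
  have hcoeff (x : ZMod N) : P.coeff x.val = G x := by
    simp only [hP, finsetSum_coeff, coeff_C_mul, coeff_X_pow]
    rw [Finset.sum_eq_single x]
    · simp
    · intro y _ hy
      rw [if_neg, mul_zero]
      exact fun e => hy (ZMod.val_injective N e.symm)
    · simp
  have hdeg : P.natDegree < N := by
    refine lt_of_le_of_lt (natDegree_sum_le_of_forall_le (n := N - 1) _ _ fun x _ => ?_)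
      (Nat.sub_lt (NeZero.pos N) one_pos)
    exact (natDegree_C_mul_X_pow_le _ _).trans (Nat.le_sub_one_of_lt (ZMod.val_lt x))
  have hζ := Complex.isPrimitiveRoot_exp N (NeZero.ne N)
  have hP0 : P = 0 := by
    refine eq_zero_of_natDegree_lt_card_of_eval_eq_zero' P (nthRootsFinset N (1 : ℂ)) ?_ ?_
    · intro w hw
      rw [mem_nthRootsFinset (NeZero.pos N)] at hw
      simpa [hP, eval_finsetSum] using h w hw
    · rwa [hζ.card_nthRootsFinset]
  ext x
  rw [← hcoeff, hP0]; simp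

theorem geom_sum_root {N : ℕ} {w : ℂ} (hw : w ^ N = 1) :
    ∑ k ∈ Finset.range N, w ^ k = if w = 1 then (N : ℂ) else 0 := by
  split_ifs with h
  · simp [h]
  · have := geom_sum_mul w N
    rw [hw, sub_self] at this
    exact (mul_eq_zero.1 this).resolve_right (sub_ne_zero.2 h)

theorem sum_zmod_eq_sum_range {N : ℕ} [NeZero N] (F : ZMod N → ℂ) :
    ∑ c, F c = ∑ i ∈ Finset.range N, F (i : ZMod N) := by
  refine Finset.sum_bij (fun x _ => x.val) (fun x _ => Finset.mem_range.2 (ZMod.val_lt x))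
    (fun x _ y _ e => ZMod.val_injective N e) (fun k hk => ⟨(k : ZMod N), Finset.mem_univ _, ?_⟩)
    (fun x _ => by rw [ZMod.natCast_zmod_val])
  rw [ZMod.val_natCast, Nat.mod_eq_of_lt (Finset.mem_range.1 hk)]

theorem sum_pow_val {N : ℕ} [NeZero N] (w : ℂ) (hw : w ^ N = 1) :
    ∑ x : ZMod N, w ^ x.val = ∑ k ∈ Finset.range N, w ^ k := by
  rw [sum_zmod_eq_sum_range]
  exact Finset.sum_congr rfl fun k _ => pow_val_natCast hw k

theorem cyclotomic_dvd_iff_aeval {d : ℕ} (hd : 0 < d) {w : ℂ} (hw : IsPrimitiveRoot w d)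
    (P : ℤ[X]) : cyclotomic d ℤ ∣ P ↔ aeval w P = 0 := by
  rw [cyclotomic_eq_minpoly hw hd, minpoly.isIntegrallyClosed_dvd_iff (hw.isIntegral hd)]

/-- `w` and `w ^ r` have the same order, hence are roots of the same cyclotomic polynomial. -/
theorem aeval_eq_zero_of_coprime_pow {N : ℕ} (hN : N ≠ 0) {w : ℂ} (hw : w ^ N = 1) {r : ℕ}
    (hr : r.Coprime N) {P : ℤ[X]} (h : aeval w P = 0) : aeval (w ^ r) P = 0 := by
  have hd : 0 < orderOf w := orderOf_pos_iff.2 (isOfFinOrder_iff_pow_eq_one.2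
    ⟨N, Nat.pos_of_ne_zero hN, hw⟩)
  have h1 := IsPrimitiveRoot.orderOf w
  have h2 := h1.pow_of_coprime r (hr.coprime_dvd_right (orderOf_dvd_of_pow_eq_one hw))
  rw [← cyclotomic_dvd_iff_aeval hd h1] at h
  exact (cyclotomic_dvd_iff_aeval hd h2 P).1 h

/-- The divisor is monic, so divisibility may be tested over `ℂ`, where it splits into distinct
linear factors. -/
theorem X_pow_sub_one_dvd_iff {N : ℕ} (hN : 0 < N) (P : ℤ[X]) :
    (X ^ N - 1 : ℤ[X]) ∣ P ↔ ∀ w : ℂ, w ^ N = 1 → aeval w P = 0 := by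
  constructor
  · rintro ⟨Q, rfl⟩ w hw
    simp [hw]
  · intro h
    have hmonic : (X ^ N - 1 : ℤ[X]).Monic := monic_X_pow_sub_C 1 hN.ne'
    rw [← map_dvd_map (Int.castRingHom ℂ) Int.cast_injective hmonic]
    simp only [Polynomial.map_sub, Polynomial.map_pow, map_X, Polynomial.map_one]
    rw [X_pow_sub_one_eq_prod hN (Complex.isPrimitiveRoot_exp N hN.ne')]
    refine Finset.prod_dvd_of_coprime
      (fun a _ b _ hab => pairwise_coprime_X_sub_C Function.injective_id hab) fun w hw => ?_
    rw [mem_nthRootsFinset hN] at hw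
    rw [dvd_iff_isRoot, IsRoot.def, eval_map, ← algebraMap_int_eq, ← aeval_def]
    exact h w hw

theorem aeval_maskPoly {M : ℕ} (w : ℂ) (A : Finset (ZMod M)) :
    aeval w (maskPoly A) = ∑ a ∈ A, w ^ a.val := by
  simp [maskPoly]

theorem isTiling_iff_aeval {N : ℕ} (hN : 0 < N) (A B : Finset (ZMod N)) :
    IsTiling A B ↔ ∀ w : ℂ, w ^ N = 1 →
      aeval w (maskPoly A) * aeval w (maskPoly B) = ∑ k ∈ Finset.range N, w ^ k := by
  rw [IsTiling, X_pow_sub_one_dvd_iff hN]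
  simp [sub_eq_zero]

/-- The pairs in `A × B` have exactly one representation of each element of `ZMod N`. -/
def RepresentsOnce {ι κ : Type*} {N : ℕ} (A : Finset ι) (B : Finset κ) (f : ι → ZMod N)
    (g : κ → ZMod N) : Prop :=
  ∀ x : ZMod N, ((A ×ˢ B).filter fun ab => f ab.1 + g ab.2 = x).card = 1

/-- The product of the two sums is the Fourier transform of the representation count, which is
determined by its transform. -/
theorem representsOnce_iff {ι κ : Type*} {N : ℕ} [NeZero N] (A : Finset ι) (B : Finset κ)
    (f : ι → ZMod N) (g : κ → ZMod N) :
    RepresentsOnce A B f g ↔ ∀ w : ℂ, w ^ N = 1 →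
      (∑ a ∈ A, w ^ (f a).val) * (∑ b ∈ B, w ^ (g b).val) = ∑ k ∈ Finset.range N, w ^ k := by
  have key (w : ℂ) (hw : w ^ N = 1) :
      (∑ a ∈ A, w ^ (f a).val) * (∑ b ∈ B, w ^ (g b).val) =
        ∑ x : ZMod N, (((A ×ˢ B).filter fun ab => f ab.1 + g ab.2 = x).card : ℂ) * w ^ x.val := by
    rw [Finset.sum_mul_sum, ← Finset.sum_product',
      ← Finset.sum_fiberwise (A ×ˢ B) (fun ab => f ab.1 + g ab.2)]
    refine Finset.sum_congr rfl fun x _ => ?_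
    rw [← nsmul_eq_mul, ← Finset.sum_const]
    refine Finset.sum_congr rfl fun ab hab => ?_
    rw [← (Finset.mem_filter.1 hab).2, pow_val_add hw]
  constructor
  · intro h w hw
    rw [key w hw, ← sum_pow_val w hw]
    exact Finset.sum_congr rfl fun x _ => by rw [h x]; simp
  · intro h x
    have := eq_zero_of_character_sums (fun x : ZMod N =>
      (((A ×ˢ B).filter fun ab => f ab.1 + g ab.2 = x).card : ℂ) - 1) fun w hw => by
        simp only [sub_mul, one_mul, Finset.sum_sub_distrib]
        rw [← key w hw, h w hw, sum_pow_val w hw, sub_self]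
    have hx := congrFun this x
    simp only [Pi.zero_apply, sub_eq_zero] at hx
    exact_mod_cast hx

theorem RepresentsOnce.eq {ι κ : Type*} {N : ℕ} {A : Finset ι} {B : Finset κ}
    {f : ι → ZMod N} {g : κ → ZMod N} (h : RepresentsOnce A B f g) {a a' : ι} {b b' : κ}
    (ha : a ∈ A) (ha' : a' ∈ A) (hb : b ∈ B) (hb' : b' ∈ B) (e : f a + g b = f a' + g b') :
    a = a' ∧ b = b' := by
  have := Finset.card_le_one.1 (h (f a' + g b')).le (a, b)
    (Finset.mem_filter.2 ⟨Finset.mk_mem_product ha hb, e⟩) (a', b')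
    (Finset.mem_filter.2 ⟨Finset.mk_mem_product ha' hb', rfl⟩)
  exact Prod.mk.inj this

theorem RepresentsOnce.nonempty {ι κ : Type*} {N : ℕ} {A : Finset ι} {B : Finset κ}
    {f : ι → ZMod N} {g : κ → ZMod N} (h : RepresentsOnce A B f g) :
    A.Nonempty ∧ B.Nonempty := by
  have h0 := h 0
  obtain ⟨ab, hab⟩ := Finset.card_pos.1 (by rw [h0]; exact one_pos)
  have := Finset.mem_product.1 (Finset.mem_filter.1 hab).1
  exact ⟨⟨_, this.1⟩, ⟨_, this.2⟩⟩

theorem representsOnce_of_injOn {ι κ : Type*} {N : ℕ} [NeZero N] {A : Finset ι} {B : Finset κ}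
    {f : ι → ZMod N} {g : κ → ZMod N}
    (hinj : ∀ a ∈ A, ∀ a' ∈ A, ∀ b ∈ B, ∀ b' ∈ B, f a + g b = f a' + g b' → a = a' ∧ b = b')
    (hcard : A.card * B.card = N) : RepresentsOnce A B f g := by
  have hi : Set.InjOn (fun ab : ι × κ => f ab.1 + g ab.2) (A ×ˢ B : Finset (ι × κ)) := by
    rintro ⟨a, b⟩ hab ⟨a', b'⟩ hab' e
    simp only [Finset.coe_product, Set.mem_prod, Finset.mem_coe] at hab hab'
    exact Prod.ext_iff.2 (hinj a hab.1 a' hab'.1 b hab.2 b' hab'.2 e)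
  intro x
  have hu : (A ×ˢ B).image (fun ab : ι × κ => f ab.1 + g ab.2) = Finset.univ := by
    rw [← Finset.card_eq_iff_eq_univ, Finset.card_image_of_injOn hi, Finset.card_product, hcard,
      ZMod.card]
  obtain ⟨ab, hab, hx⟩ := Finset.mem_image.1 (hu ▸ Finset.mem_univ x)
  refine Finset.card_eq_one.2 ⟨ab, Finset.ext fun cd => ?_⟩
  rw [Finset.mem_filter, Finset.mem_singleton]
  constructor
  · rintro ⟨h1, h2⟩
    exact hi h1 hab (h2.trans hx.symm)
  · rintro rfl
    exact ⟨hab, hx⟩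

/-- Unique representation already forces injectivity on each factor, because the other factor is
nonempty. -/
theorem isTilingMod_iff_representsOnce {M N : ℕ} [NeZero M] [NeZero N]
    (A B : Finset (ZMod M)) :
    IsTilingMod N A B ↔
      RepresentsOnce A B (fun a => (a.cast : ZMod N)) (fun b => (b.cast : ZMod N)) := by
  have sums {S : Finset (ZMod M)} (hS : Set.InjOn (fun a : ZMod M => (a.cast : ZMod N)) S)
      (w : ℂ) : aeval w (maskPoly (S.image fun a => (a.cast : ZMod N))) =
        ∑ a ∈ S, w ^ (a.cast : ZMod N).val := by
    rw [aeval_maskPoly, Finset.sum_image hS]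
  constructor
  · rintro ⟨hA, hB, h⟩
    rw [isTiling_iff_aeval (NeZero.pos N)] at h
    rw [representsOnce_iff]
    intro w hw
    rw [← h w hw, sums hA, sums hB]
  · intro h
    obtain ⟨⟨a, ha⟩, ⟨b, hb⟩⟩ := h.nonempty
    have hA : Set.InjOn (fun a : ZMod M => (a.cast : ZMod N)) A := fun x hx y hy e =>
      (h.eq hx hy hb hb (congrArg (· + (b.cast : ZMod N)) e)).1
    have hB : Set.InjOn (fun a : ZMod M => (a.cast : ZMod N)) B := fun x hx y hy e =>
      (h.eq ha ha hx hy (congrArg ((a.cast : ZMod N) + ·) e)).2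
    refine ⟨hA, hB, (isTiling_iff_aeval (NeZero.pos N) _ _).2 fun w hw => ?_⟩
    rw [sums hA, sums hB, (representsOnce_iff A B _ _).1 h w hw]

theorem isTilingMod_iff_aeval {M N : ℕ} [NeZero M] [NeZero N]
    (A B : Finset (ZMod M)) :
    IsTilingMod N A B ↔ ∀ w : ℂ, w ^ N = 1 →
      aeval w (maskPoly A) * aeval w (maskPoly B) = ∑ k ∈ Finset.range N, w ^ k := by
  rw [isTilingMod_iff_representsOnce, representsOnce_iff]
  refine forall₂_congr fun w hw => ?_
  simp only [pow_val_cast hw, aeval_maskPoly]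

theorem isTiling_iff_isTilingMod {M : ℕ} [NeZero M] (A B : Finset (ZMod M)) :
    IsTiling A B ↔ IsTilingMod M A B := by
  rw [isTiling_iff_aeval (NeZero.pos M), isTilingMod_iff_aeval]

theorem card_mul_card_of_isTilingMod {M N : ℕ} [NeZero M] [NeZero N]
    {A B : Finset (ZMod M)} (h : IsTilingMod N A B) : A.card * B.card = N := by
  have := (isTilingMod_iff_aeval A B).1 h 1 (one_pow _)
  simp only [aeval_maskPoly, one_pow, Finset.sum_const, nsmul_eq_mul, mul_one,
    Finset.card_range] at this
  exact_mod_cast this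

/-- A factor of a tiling may be multiplied by a number prime to the modulus. -/
theorem IsTilingMod.representsOnce_mul {M N : ℕ} [NeZero M] [NeZero N]
    {A B : Finset (ZMod M)} (h : IsTilingMod N A B) {r : ℕ} (hr : r.Coprime N) :
    RepresentsOnce A B (fun a => (r : ZMod N) * (a.cast : ZMod N))
      (fun b => (b.cast : ZMod N)) := by
  rw [isTilingMod_iff_aeval] at h
  rw [representsOnce_iff]
  intro w hw
  have hwr : (w ^ r) ^ N = 1 := by rw [← pow_mul, mul_comm, pow_mul, hw, one_pow]
  have e1 : ∑ a ∈ A, w ^ ((r : ZMod N) * (a.cast : ZMod N)).val = aeval (w ^ r) (maskPoly A) := by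
    rw [aeval_maskPoly]
    refine Finset.sum_congr rfl fun a _ => ?_
    rw [pow_val_mul hw, pow_val_natCast hw, pow_val_cast hwr]
  have e2 : ∑ b ∈ B, w ^ (b.cast : ZMod N).val = aeval w (maskPoly B) := by
    rw [aeval_maskPoly]
    exact Finset.sum_congr rfl fun a _ => by rw [pow_val_cast hw]
  rw [e1, e2]
  by_cases h1 : w = 1
  · subst h1
    rw [one_pow]; exact h 1 hw
  · have h0 := h w hw
    rw [geom_sum_root hw, if_neg h1] at h0 ⊢
    rcases mul_eq_zero.1 h0 with h0 | h0
    · rw [aeval_eq_zero_of_coprime_pow (NeZero.ne N) hw hr h0, zero_mul]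
    · rw [h0, mul_zero]

/-- Each residue is a unit times its gcd with `N`. -/
theorem exists_coprime_mul_eq {N : ℕ} [NeZero N] {x y : ZMod N}
    (h : Nat.gcd x.val N = Nat.gcd y.val N) : ∃ r : ℕ, r.Coprime N ∧ (r : ZMod N) * x = y := by
  have key (z : ZMod N) : ∃ u : (ZMod N)ˣ, z = u * (Nat.gcd z.val N : ℕ) := by
    obtain ⟨d, hd, u, hu, rfl⟩ := z.eq_unit_mul_divisor
    refine ⟨hu.unit, ?_⟩
    have hc : u.val.Coprime N := ZMod.val_coe_unit_coprime hu.unit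
    rw [IsUnit.unit_spec]
    congr 2
    have : u * (d : ZMod N) = ((u.val * d : ℕ) : ZMod N) := by simp
    rw [this, ZMod.val_natCast, (Nat.mod_modEq _ _).gcd_eq]
    rw [Nat.Coprime.gcd_mul_left_cancel _ hc, Nat.gcd_eq_left hd]
  obtain ⟨u, hu⟩ := key x
  obtain ⟨v, hv⟩ := key y
  refine ⟨((v * u⁻¹ : (ZMod N)ˣ) : ZMod N).val, ZMod.val_coe_unit_coprime _, ?_⟩
  rw [ZMod.natCast_zmod_val, hu, hv, ← h]
  push_cast
  rw [mul_assoc, ← mul_assoc (((u⁻¹ : (ZMod N)ˣ)) : ZMod N)]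
  simp

/-- Sands's theorem: the divisor sets of the two factors of a tiling meet only trivially. -/
theorem IsTilingMod.eq_of_gcd_eq {M N : ℕ} [NeZero M] [NeZero N] (hNM : N ∣ M)
    {A B : Finset (ZMod M)} (h : IsTilingMod N A B) {a a' b b' : ZMod M}
    (ha : a ∈ A) (ha' : a' ∈ A) (hb : b ∈ B) (hb' : b' ∈ B)
    (hg : Nat.gcd (a - a').val N = Nat.gcd (b - b').val N) : a = a' ∧ b = b' := by
  have cast_gcd (x : ZMod M) : Nat.gcd (x.cast : ZMod N).val N = Nat.gcd x.val N := by
    have : (x.cast : ZMod N) = ((x.val : ℕ) : ZMod N) := by rw [ZMod.natCast_val]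
    rw [this, ZMod.val_natCast, (Nat.mod_modEq _ _).gcd_eq]
  obtain ⟨r, hr, e⟩ := exists_coprime_mul_eq
    (x := ((a - a').cast : ZMod N)) (y := ((b - b').cast : ZMod N)) (by
      rw [cast_gcd, cast_gcd, hg])
  rw [ZMod.cast_sub hNM, ZMod.cast_sub hNM] at e
  -- `r (a - a') = b - b'` gives two representations `r a + b' = r a' + b` in the tiling by `r A`
  -- and `B`.
  obtain ⟨h1, h2⟩ := (h.representsOnce_mul hr).eq ha ha' hb' hb
    (show (r : ZMod N) * (a.cast : ZMod N) + (b'.cast : ZMod N) = r * a'.cast + b.cast by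
      linear_combination e)
  exact ⟨h1, h2.symm⟩

end CharacterSums

/-! ### Periodicity, window sums and Fourier transforms on cyclic groups -/

section Windows

theorem sum_range_mul_of_periodic {F : ℕ → ℂ} {L : ℕ} (h : ∀ i, F (i + L) = F i) (k : ℕ) :
    ∑ i ∈ Finset.range (k * L), F i = k * ∑ i ∈ Finset.range L, F i := by
  have hk (k i : ℕ) : F (k * L + i) = F i := by
    induction k with
    | zero => simp
    | succ k ih => rw [Nat.succ_mul, add_right_comm, h, ih]
  induction k with
  | zero => simp
  | succ k ih =>
    rw [Nat.succ_mul, Finset.sum_range_add, ih]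
    simp only [hk]
    push_cast; ring

theorem mul_window_sum_of_periodic {k L : ℕ} [NeZero (k * L)] {F : ZMod (k * L) → ℂ}
    (h : ∀ c, F (c + (L : ℕ)) = F c) (τ : ZMod (k * L)) :
    k * ∑ i ∈ Finset.range L, F ((i : ZMod (k * L)) + τ) = ∑ c, F c := by
  rw [← Equiv.sum_comp (Equiv.addRight τ) F, sum_zmod_eq_sum_range]
  simp only [Equiv.coe_addRight]
  rw [sum_range_mul_of_periodic (F := fun i => F ((i : ZMod (k * L)) + τ))]
  intro i
  rw [← h ((i : ZMod (k * L)) + τ)]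
  congr 1
  push_cast; ring

/-- Sliding a window by one step changes its sum by `F (c + L) - F c`. -/
theorem periodic_of_window_sum_eq_zero {N L : ℕ} {F : ZMod N → ℂ}
    (h : ∀ τ, ∑ i ∈ Finset.range L, F ((i : ZMod N) + τ) = 0) (c : ZMod N) :
    F (c + (L : ℕ)) = F c := by
  have h1 := Finset.sum_range_succ (fun i : ℕ => F ((i : ZMod N) + c)) L
  have h2 := Finset.sum_range_succ' (fun i : ℕ => F ((i : ZMod N) + c)) L
  have h3 : ∑ i ∈ Finset.range L, F (((i + 1 : ℕ) : ZMod N) + c) = 0 := by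
    rw [← h (1 + c)]
    refine Finset.sum_congr rfl fun i _ => ?_
    push_cast; rw [add_assoc]
  rw [h c] at h1
  rw [h3, h1] at h2
  simpa [add_comm] using h2

/-- A function on `ZMod (p ^ (m + 1))` is `p ^ m`-periodic iff its Fourier transform vanishes at
all primitive frequencies. -/
theorem periodic_iff_character_sums {p : ℕ} (hp : p.Prime) (m : ℕ)
    [NeZero (p ^ (m + 1))] (F : ZMod (p ^ (m + 1)) → ℂ) :
    (∀ c, F (c + ((p ^ m : ℕ))) = F c) ↔
      ∀ σ : ℂ, IsPrimitiveRoot σ (p ^ (m + 1)) → ∑ c, F c * σ ^ c.val = 0 := by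
  have shift (σ : ℂ) (hσ : σ ^ p ^ (m + 1) = 1) :
      ∑ c, F c * σ ^ c.val = σ ^ p ^ m * ∑ c, F (c + ((p ^ m : ℕ))) * σ ^ c.val := by
    rw [← Equiv.sum_comp (Equiv.addRight ((p ^ m : ℕ) : ZMod (p ^ (m + 1)))), Finset.mul_sum]
    refine Finset.sum_congr rfl fun c _ => ?_
    rw [Equiv.coe_addRight, pow_val_add hσ, pow_val_natCast hσ]
    ring
  constructor
  · intro h σ hσ
    have h1 := shift σ hσ.pow_eq_one
    simp only [h] at h1
    have h2 : σ ^ p ^ m ≠ 1 :=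
      hσ.pow_ne_one_of_pos_of_lt (pow_ne_zero _ hp.ne_zero)
        (Nat.pow_lt_pow_right hp.one_lt (Nat.lt_succ_self m))
    have h3 : (1 - σ ^ p ^ m) * ∑ c, F c * σ ^ c.val = 0 := by
      linear_combination h1
    exact (mul_eq_zero.1 h3).resolve_left (sub_ne_zero.2 h2.symm)
  · intro h
    -- The difference has zero transform everywhere: at imprimitive `σ` we have `σ ^ p ^ m = 1` and
    -- a shift changes nothing; at primitive `σ` the hypothesis applies.
    have := eq_zero_of_character_sums
      (fun c : ZMod (p ^ (m + 1)) => F (c + ((p ^ m : ℕ))) - F c) fun σ hσ => by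
      simp only [sub_mul, Finset.sum_sub_distrib]
      by_cases h1 : σ ^ p ^ m = 1
      · rw [shift σ hσ, h1, one_mul, sub_self]
      · have hprim : IsPrimitiveRoot σ (p ^ (m + 1)) := by
          have : Fact p.Prime := ⟨hp⟩
          rw [← orderOf_eq_prime_pow h1 hσ]
          exact IsPrimitiveRoot.orderOf σ
        have h2 := h σ hprim
        have h3 := shift σ hσ
        rw [h2, eq_comm, mul_eq_zero] at h3
        rw [h2, sub_zero]
        refine h3.resolve_left fun h0 => ?_
        have : σ ≠ 0 := by
          rintro rfl
          rw [zero_pow (pow_ne_zero _ hp.ne_zero)] at hσ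
          exact zero_ne_one hσ
        exact pow_ne_zero _ this h0
    exact fun c => sub_eq_zero.1 (congrFun this c)

theorem isPrimitiveRoot_mul_of_prime_pow {p : ℕ} (hp : p.Prime) {m j e : ℕ} (hj : j ≤ m)
    (he : 0 < e) (hpe : ¬ p ∣ e) {s w : ℂ} (hs : IsPrimitiveRoot s (p ^ (m + 1)))
    (hw : IsPrimitiveRoot w (p ^ j * e)) : IsPrimitiveRoot (s * w) (p ^ (m + 1) * e) := by
  have hone (k : ℕ) (hk : j ≤ k) : w ^ (p ^ k * e) = 1 :=
    (hw.pow_eq_one_iff_dvd _).2 (Nat.mul_dvd_mul_right (pow_dvd_pow p hk) e)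
  rw [IsPrimitiveRoot.iff_orderOf]
  refine orderOf_eq_of_pow_and_pow_div_prime (Nat.mul_pos (pow_pos hp.pos _) he) ?_ ?_
  · rw [mul_pow, hone _ (hj.trans (Nat.le_succ m)), pow_mul, hs.pow_eq_one, one_pow, one_mul]
  · intro r hr hrd
    rw [mul_pow]
    by_cases hrp : r = p
    · subst hrp
      have : r ^ (m + 1) * e / r = r ^ m * e := by
        rw [pow_succ', mul_assoc, Nat.mul_div_cancel_left _ hr.pos]
      rw [this, hone m hj, mul_one, Ne, hs.pow_eq_one_iff_dvd, pow_succ]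
      exact fun h => hpe (Nat.dvd_of_mul_dvd_mul_left (pow_pos hr.pos _) h)
    · have hre : r ∣ e := by
        refine Nat.Coprime.dvd_of_dvd_mul_left ?_ hrd
        exact Nat.Coprime.pow_right _ ((Nat.coprime_primes hr hp).2 hrp)
      obtain ⟨f, rfl⟩ := hre
      have h1 : p ^ (m + 1) * (r * f) / r = p ^ (m + 1) * f := by
        rw [mul_left_comm, Nat.mul_div_cancel_left _ hr.pos]
      have hf : 0 < f := Nat.pos_of_mul_pos_left he
      rw [h1, pow_mul s, hs.pow_eq_one, one_pow, one_mul, Ne, hw.pow_eq_one_iff_dvd]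
      intro h
      have h2 : r * f ∣ f := by
        refine Nat.Coprime.dvd_of_dvd_mul_left ?_ ((Dvd.intro_left _ rfl).trans h)
        exact (((Nat.Prime.coprime_iff_not_dvd hp).2 hpe).pow_left _).symm
      have h3 := Nat.le_of_dvd hf h2
      nlinarith [hr.two_le]

end Windows

/-! ### Fibre sums along the coordinate `π_p` -/

section ArrayCoordinate

open Polynomial

variable {M p : ℕ}

theorem arrayCoord_add (x y : ZMod M) :
    arrayCoord p (x + y) = arrayCoord p x + arrayCoord p y := by
  rw [arrayCoord, ZMod.cast_add (Nat.ordProj_dvd M p), add_mul]; rfl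

theorem arrayCoord_sub (x y : ZMod M) :
    arrayCoord p (x - y) = arrayCoord p x - arrayCoord p y := by
  rw [arrayCoord, ZMod.cast_sub (Nat.ordProj_dvd M p), sub_mul]; rfl

theorem arrayCoord_mul_ordCompl [NeZero M] (hp : p ∈ M.primeFactors) (x : ZMod M) :
    arrayCoord p x * ((M / p ^ M.factorization p : ℕ) : ZMod (p ^ M.factorization p)) =
      ((x.val : ℕ) : ZMod (p ^ M.factorization p)) := by
  rw [arrayCoord, mul_assoc, mul_comm (_⁻¹), arrayCoord_unit (NeZero.ne M) hp, mul_one,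
    ZMod.natCast_val]

/-- `x ≡ π_p(x) M_p` modulo `p ^ n`, and `M_p` is prime to `p`. -/
theorem pow_dvd_arrayCoord_iff [NeZero M] (hp : p ∈ M.primeFactors) {i : ℕ}
    (hi : i ≤ M.factorization p) (x : ZMod M) :
    p ^ i ∣ (arrayCoord p x).val ↔ p ^ i ∣ x.val := by
  have hpp := Nat.prime_of_mem_primeFactors hp
  have : NeZero (p ^ M.factorization p) := ⟨pow_ne_zero _ hpp.ne_zero⟩
  have h1 := arrayCoord_mul_ordCompl hp x
  rw [← ZMod.natCast_zmod_val (arrayCoord p x), ← Nat.cast_mul, ZMod.natCast_eq_natCast_iff] at h1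
  rw [← (h1.of_dvd (pow_dvd_pow p hi)).dvd_iff dvd_rfl]
  exact (Nat.Coprime.dvd_mul_right
    (Nat.Coprime.pow_left _ (Nat.coprime_ordCompl hpp (NeZero.ne M)))).symm

theorem arrayCoord_eq_zero_of_dvd [NeZero M] {x : ZMod M}
    (h : p ^ M.factorization p ∣ x.val) : arrayCoord p x = 0 := by
  rw [arrayCoord, ← ZMod.natCast_val, (ZMod.natCast_eq_zero_iff _ _).2 h, zero_mul]

theorem arrayCoord_surjective [NeZero M] (hp : p ∈ M.primeFactors)
    (c : ZMod (p ^ M.factorization p)) : ∃ x : ZMod M, arrayCoord p x = c := by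
  have : NeZero (p ^ M.factorization p) :=
    ⟨pow_ne_zero _ (Nat.prime_of_mem_primeFactors hp).ne_zero⟩
  refine ⟨((c.val * (M / p ^ M.factorization p) : ℕ) : ZMod M), ?_⟩
  rw [arrayCoord, ZMod.cast_natCast (Nat.ordProj_dvd M p), Nat.cast_mul, mul_assoc,
    arrayCoord_unit (NeZero.ne M) hp, mul_one, ZMod.natCast_zmod_val]

/-- The part of the character sum of `A` at `w` over the elements with array coordinate `c`. -/
def fiberSum (p : ℕ) (A : Finset (ZMod M)) (w : ℂ) (c : ZMod (p ^ M.factorization p)) : ℂ :=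
  ∑ a ∈ A with arrayCoord p a = c, w ^ a.val

theorem sum_fiberSum [NeZero (p ^ M.factorization p)] (A : Finset (ZMod M)) (w : ℂ) :
    ∑ c, fiberSum p A w c = aeval w (maskPoly A) := by
  rw [aeval_maskPoly]
  exact Finset.sum_fiberwise A (arrayCoord p) _

/-- Since `π_p(a)` is `a` times the inverse of `M_p`, the twist by `σ` is absorbed into the
evaluation point. -/
theorem sum_fiberSum_mul_pow [NeZero M] [NeZero (p ^ M.factorization p)]
    (A : Finset (ZMod M)) (w : ℂ) {σ : ℂ} (hσ : σ ^ p ^ M.factorization p = 1) :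
    ∑ c, fiberSum p A w c * σ ^ c.val =
      aeval (σ ^ ((M / p ^ M.factorization p : ℕ) : ZMod (p ^ M.factorization p))⁻¹.val * w)
        (maskPoly A) := by
  rw [aeval_maskPoly, ← Finset.sum_fiberwise A (arrayCoord p)]
  refine Finset.sum_congr rfl fun c _ => ?_
  rw [fiberSum, Finset.sum_mul]
  refine Finset.sum_congr rfl fun a ha => ?_
  rw [← (Finset.mem_filter.1 ha).2, arrayCoord, pow_val_mul hσ, pow_val_cast hσ, mul_pow,
    ← pow_mul, ← pow_mul, mul_comm, mul_comm a.val]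

/-- The element `t + a` lies in the slab iff `π_p(a)` lies in the window starting at `-π_p(t)`. -/
theorem aeval_slab_translate [NeZero M] (hp : p.Prime) (A : Finset (ZMod M)) (t : ZMod M)
    {w : ℂ} (hw : w ^ M = 1) :
    aeval w (maskPoly (slab p (translateSet t A))) = w ^ t.val *
      ∑ i ∈ Finset.range (p ^ (M.factorization p - 1)),
        fiberSum p A w ((i : ZMod (p ^ M.factorization p)) + -arrayCoord p t) := by
  have : NeZero (p ^ M.factorization p) := ⟨pow_ne_zero _ hp.ne_zero⟩
  have hL : 0 < p ^ (M.factorization p - 1) := pow_pos hp.pos _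
  rw [aeval_maskPoly, slab, translateSet, Finset.filter_image,
    Finset.sum_image (fun x _ y _ e => add_left_cancel e)]
  simp only [pow_val_add hw]
  rw [← Finset.mul_sum]
  congr 1
  rw [← Finset.sum_fiberwise_of_maps_to (t := Finset.range (p ^ (M.factorization p - 1)))
    (g := fun a => (arrayCoord p (t + a)).val)]
  · refine Finset.sum_congr rfl fun i hi => ?_
    rw [Finset.mem_range] at hi
    have hiq : i < p ^ M.factorization p :=
      hi.trans_le (Nat.pow_le_pow_right hp.pos (Nat.sub_le _ _))
    rw [fiberSum]
    refine Finset.sum_congr (Finset.ext fun a => ?_) fun _ _ => rfl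
    rw [Finset.filter_filter, Finset.mem_filter, Finset.mem_filter, arrayCoord_add]
    refine and_congr_right fun _ => ?_
    constructor
    · rintro ⟨_, h⟩
      rw [← h, ZMod.natCast_zmod_val]; ring
    · intro h
      have : (arrayCoord p t + arrayCoord p a).val = i := by
        rw [h, add_neg_cancel_comm_assoc, ZMod.val_natCast, Nat.mod_eq_of_lt hiq]
      exact ⟨by omega, this⟩
  · intro a ha
    rw [Finset.mem_range]
    have := (Finset.mem_filter.1 ha).2
    omega

/-- `Φ_{p ^ n e}` divides the mask polynomial of `A` iff the fibre sums of `A` at a root of unity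
of order `p ^ j e` with `j < n` have period `p ^ (n - 1)`. -/
theorem cyclotomic_dvd_iff_fiberSum_periodic [NeZero M] (hp : p ∈ M.primeFactors)
    (A : Finset (ZMod M)) {j e : ℕ} (hj : j < M.factorization p) (he : 0 < e) (hpe : ¬ p ∣ e)
    {w : ℂ} (hw : IsPrimitiveRoot w (p ^ j * e)) :
    cyclotomic (p ^ M.factorization p * e) ℤ ∣ maskPoly A ↔
      ∀ c, fiberSum p A w (c + ((p ^ (M.factorization p - 1) : ℕ))) = fiberSum p A w c := by
  have hpp := Nat.prime_of_mem_primeFactors hp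
  have hq0 : p ^ M.factorization p ≠ 0 := pow_ne_zero _ hpp.ne_zero
  have : NeZero (p ^ M.factorization p) := ⟨hq0⟩
  have hκ : (((M / p ^ M.factorization p : ℕ) :
      ZMod (p ^ M.factorization p))⁻¹.val).Coprime (p ^ M.factorization p) :=
    ZMod.val_coe_unit_coprime (Units.mkOfMulEqOne _ _ ((mul_comm _ _).trans
      (arrayCoord_unit (NeZero.ne M) hp)))
  have hprim {σ : ℂ} (hσ : IsPrimitiveRoot σ (p ^ M.factorization p)) :
      IsPrimitiveRoot (σ ^ ((M / p ^ M.factorization p : ℕ) :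
        ZMod (p ^ M.factorization p))⁻¹.val * w) (p ^ M.factorization p * e) := by
    have h1 := hσ.pow_of_coprime _ hκ
    obtain ⟨m, hm⟩ := Nat.exists_eq_add_of_lt (Nat.zero_lt_of_lt hj)
    rw [zero_add] at hm
    generalize σ ^ ((M / p ^ M.factorization p : ℕ) :
      ZMod (p ^ M.factorization p))⁻¹.val = s at h1 ⊢
    rw [hm] at h1 hj ⊢
    exact isPrimitiveRoot_mul_of_prime_pow hpp (Nat.le_of_lt_succ hj) he hpe h1 hw
  have hiff : (∀ c, fiberSum p A w (c + ((p ^ (M.factorization p - 1) : ℕ))) = fiberSum p A w c) ↔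
      ∀ σ : ℂ, IsPrimitiveRoot σ (p ^ M.factorization p) →
        ∑ c, fiberSum p A w c * σ ^ c.val = 0 := by
    generalize fiberSum p A w = F
    revert F this
    rw [← Nat.sub_add_cancel (Nat.one_le_of_lt hj), Nat.add_sub_cancel]
    intro _ F
    convert periodic_iff_character_sums hpp (M.factorization p - 1) F
  rw [hiff]
  have hpos : 0 < p ^ M.factorization p * e := Nat.mul_pos (Nat.pos_of_ne_zero hq0) he
  constructor
  · intro h σ hσ
    rw [sum_fiberSum_mul_pow A w hσ.pow_eq_one]
    exact (cyclotomic_dvd_iff_aeval hpos (hprim hσ) _).1 h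
  · intro h
    have hσ := Complex.isPrimitiveRoot_exp _ hq0
    have := h _ hσ
    rw [sum_fiberSum_mul_pow A w hσ.pow_eq_one] at this
    exact (cyclotomic_dvd_iff_aeval hpos (hprim hσ) _).2 this

/-- If the fibre sums are periodic, every slab carries a `p`-th of the character sum. -/
theorem mul_aeval_slab_translate [NeZero M] (hp : p ∈ M.primeFactors) (A : Finset (ZMod M))
    (t : ZMod M) {w : ℂ} (hw : w ^ M = 1)
    (h : ∀ c, fiberSum p A w (c + ((p ^ (M.factorization p - 1) : ℕ))) = fiberSum p A w c) :
    p * aeval w (maskPoly (slab p (translateSet t A))) = w ^ t.val * aeval w (maskPoly A) := by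
  have hpp := Nat.prime_of_mem_primeFactors hp
  have : NeZero (p ^ M.factorization p) := ⟨pow_ne_zero _ hpp.ne_zero⟩
  have hn : 0 < M.factorization p :=
    hpp.factorization_pos_of_dvd (NeZero.ne M) (Nat.dvd_of_mem_primeFactors hp)
  rw [aeval_slab_translate hpp A t hw, ← sum_fiberSum (p := p), mul_left_comm]
  congr 1
  generalize -arrayCoord p t = τ
  generalize fiberSum p A w = F at h
  revert F τ this
  have e : p ^ M.factorization p = p * p ^ (M.factorization p - 1) := by
    rw [← pow_succ', Nat.sub_add_cancel hn]
  rw [e]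
  intro _ τ F h
  convert mul_window_sum_of_periodic h τ

end ArrayCoordinate

/-! ### Comparing gcds with `M` and with `M / p` -/

section GcdArithmetic

variable {p m K : ℕ}

theorem gcd_prime_pow_succ_mul_of_not_dvd (hp : p.Prime) (hK : p.Coprime K) {X : ℕ}
    (hX : ¬ p ^ (m + 1) ∣ X) : Nat.gcd X (p ^ (m + 1) * K) = Nat.gcd X (p ^ m * K) := by
  rw [Nat.Coprime.gcd_mul X (hK.pow_left _), Nat.Coprime.gcd_mul X (hK.pow_left _)]
  congr 1
  obtain ⟨i, hi, h⟩ := (Nat.dvd_prime_pow hp).1 (Nat.gcd_dvd_right X (p ^ (m + 1)))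
  have him : i ≤ m := by
    by_contra hlt
    have : i = m + 1 := by omega
    subst this
    exact hX (h ▸ Nat.gcd_dvd_left _ _)
  refine Nat.dvd_antisymm (Nat.dvd_gcd (Nat.gcd_dvd_left _ _) ?_)
    (Nat.gcd_dvd_gcd_of_dvd_right _ (pow_dvd_pow p (Nat.le_succ m)))
  rw [h]
  exact pow_dvd_pow p him

theorem gcd_prime_pow_succ_mul_of_dvd (hK : p.Coprime K) {X : ℕ}
    (hX : p ^ (m + 1) ∣ X) : Nat.gcd X (p ^ (m + 1) * K) = p * Nat.gcd X (p ^ m * K) := by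
  rw [Nat.Coprime.gcd_mul X (hK.pow_left _), Nat.Coprime.gcd_mul X (hK.pow_left _),
    Nat.gcd_eq_right hX, Nat.gcd_eq_right ((pow_dvd_pow p (Nat.le_succ m)).trans hX)]
  ring

end GcdArithmetic

/-! ### The two equivalences for slabs -/

section SlabReduction

open Polynomial

variable {M p : ℕ}

/-- Used to assemble the product in (ii). Distinct cyclotomic polynomials need not generate the unit
ideal of `ℤ[X]`, so only the absence of common factors is claimed. -/
theorem isRelPrime_cyclotomic {a b : ℕ} (ha : 0 < a) (hb : 0 < b) (hab : a ≠ b) :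
    IsRelPrime (cyclotomic a ℤ) (cyclotomic b ℤ) := by
  rw [(cyclotomic.irreducible ha).isRelPrime_iff_not_dvd]
  intro h
  have := (cyclotomic.irreducible ha).associated_of_dvd (cyclotomic.irreducible hb) h
  exact hab (cyclotomic_injective (R := ℤ)
    (eq_of_monic_of_associated (cyclotomic.monic a ℤ) (cyclotomic.monic b ℤ) this))

/-- Slab coordinates are below `p ^ (n - 1)`, so coordinates congruent modulo `p ^ (n - 1)` are
equal. -/
theorem pow_dvd_val_sub_of_mem_slab [NeZero M] (hp : p ∈ M.primeFactors) {A : Finset (ZMod M)}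
    {a a' : ZMod M} (ha : a ∈ slab p A) (ha' : a' ∈ slab p A)
    (h : p ^ (M.factorization p - 1) ∣ (a - a').val) :
    p ^ M.factorization p ∣ (a - a').val := by
  have hpp := Nat.prime_of_mem_primeFactors hp
  have : NeZero (p ^ M.factorization p) := ⟨pow_ne_zero _ hpp.ne_zero⟩
  have hL : 0 < p ^ (M.factorization p - 1) := pow_pos hpp.pos _
  have h1 := (Finset.mem_filter.1 ha).2
  have h2 := (Finset.mem_filter.1 ha').2
  rw [← pow_dvd_arrayCoord_iff hp (Nat.sub_le _ _)] at h
  have h3 : arrayCoord p a = arrayCoord p a' + arrayCoord p (a - a') := by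
    rw [arrayCoord_sub]; ring
  have h4 : (arrayCoord p a).val ≡ (arrayCoord p a').val [MOD p ^ (M.factorization p - 1)] := by
    rw [h3, ZMod.val_add]
    refine ((Nat.mod_modEq _ _).of_dvd (pow_dvd_pow p (Nat.sub_le _ _))).trans ?_
    exact Nat.ModEq.add_left _ ((Nat.modEq_zero_iff_dvd).2 h)
  have h5 : arrayCoord p a = arrayCoord p a' :=
    ZMod.val_injective _ (h4.eq_of_lt_of_lt (by omega) (by omega))
  rw [← pow_dvd_arrayCoord_iff hp le_rfl, arrayCoord_sub, h5, sub_self, ZMod.val_zero]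
  exact dvd_zero _

theorem fiberSum_one_periodic [NeZero M] (hp : p ∈ M.primeFactors) {A : Finset (ZMod M)}
    (hA : cyclotomic (p ^ M.factorization p) ℤ ∣ maskPoly A) (c : ZMod (p ^ M.factorization p)) :
    fiberSum p A 1 (c + ((p ^ (M.factorization p - 1) : ℕ))) = fiberSum p A 1 c := by
  have hpp := Nat.prime_of_mem_primeFactors hp
  have hn : 0 < M.factorization p :=
    hpp.factorization_pos_of_dvd (NeZero.ne M) (Nat.dvd_of_mem_primeFactors hp)
  refine (cyclotomic_dvd_iff_fiberSum_periodic hp A (j := 0) (e := 1) hn one_pos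
    hpp.not_dvd_one (by simp)).1 ?_ c
  rwa [mul_one]

variable [NeZero M] [NeZero (M / p)]

theorem slab_tiling_iff_cyclotomic (hp : p ∈ M.primeFactors) {A B : Finset (ZMod M)}
    (hAB : IsTiling A B) (hA : cyclotomic (p ^ M.factorization p) ℤ ∣ maskPoly A) :
    (∀ t : ZMod M, IsTilingMod (M / p) (slab p (translateSet t A)) B) ↔
      ∀ d : ℕ, p ^ M.factorization p ∣ d → d ∣ M → cyclotomic d ℤ ∣ maskPoly A ∨
        (∏ α ∈ Finset.Icc 1 (M.factorization p), cyclotomic (d / p ^ α) ℤ) ∣ maskPoly B := by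
  have hpp := Nat.prime_of_mem_primeFactors hp
  have hpM := Nat.dvd_of_mem_primeFactors hp
  have hM0 := NeZero.ne M
  have hMN : M = p * (M / p) := (Nat.mul_div_cancel' hpM).symm
  have hp0 : (p : ℂ) ≠ 0 := Nat.cast_ne_zero.2 hpp.ne_zero
  have rootM {w : ℂ} (hw : w ^ (M / p) = 1) : w ^ M = 1 := by
    rw [hMN, mul_comm, pow_mul, hw, one_pow]
  rw [isTiling_iff_aeval (NeZero.pos M)] at hAB
  simp only [isTilingMod_iff_aeval]
  constructor
  · intro h d hpd hdM
    rw [or_iff_not_imp_left]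
    intro hd
    obtain ⟨e, rfl⟩ := hpd
    have he : 0 < e := Nat.pos_of_ne_zero fun h0 => hM0 (by
      rw [h0, mul_zero, zero_dvd_iff] at hdM; exact hdM)
    have hpe : ¬ p ∣ e := fun hpe => by
      refine Nat.pow_succ_factorization_not_dvd hM0 hpp ((Dvd.dvd.trans ?_ hdM))
      rw [pow_succ]
      exact Nat.mul_dvd_mul_left _ hpe
    have hdiv {α : ℕ} (hα : α ≤ M.factorization p) :
        p ^ M.factorization p * e / p ^ α = p ^ (M.factorization p - α) * e := by
      rw [Nat.mul_div_right_comm (pow_dvd_pow p hα), Nat.pow_div hα hpp.pos]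
    refine Finset.prod_dvd_of_isRelPrime ?_ ?_
    · intro α hα β hβ hαβ
      rw [Finset.mem_coe, Finset.mem_Icc] at hα hβ
      simp only [Function.onFun]
      rw [hdiv hα.2, hdiv hβ.2]
      refine isRelPrime_cyclotomic (Nat.mul_pos (pow_pos hpp.pos _) he)
        (Nat.mul_pos (pow_pos hpp.pos _) he) fun heq => hαβ ?_
      have := Nat.pow_right_injective hpp.two_le (Nat.eq_of_mul_eq_mul_right he heq)
      omega
    · intro α hα
      rw [Finset.mem_Icc] at hα
      rw [hdiv hα.2]
      have hj : M.factorization p - α < M.factorization p := by omega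
      generalize M.factorization p - α = j at hj
      have hpos : 0 < p ^ j * e := Nat.mul_pos (pow_pos hpp.pos _) he
      have hw := Complex.isPrimitiveRoot_exp _ hpos.ne'
      generalize Complex.exp _ = w at hw
      have hwN : w ^ (M / p) = 1 := by
        rw [hw.pow_eq_one_iff_dvd, Nat.dvd_div_iff_mul_dvd hpM, ← mul_assoc, ← pow_succ']
        exact (Nat.mul_dvd_mul_right (pow_dvd_pow p hj) e).trans hdM
      -- `w = 1` would mean `d = p ^ n`, and `Φ_{p ^ n} ∣ A` is given.
      have hw1 : w ≠ 1 := by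
        rintro rfl
        have h1 := hw.eq_orderOf
        rw [orderOf_one] at h1
        rw [Nat.eq_one_of_mul_eq_one_left h1, mul_one] at hd
        exact hd hA
      rw [cyclotomic_dvd_iff_aeval hpos hw]
      by_contra hB
      refine hd ((cyclotomic_dvd_iff_fiberSum_periodic hp A hj he hpe hw).2
        (periodic_of_window_sum_eq_zero fun τ => ?_))
      -- The translate by this `t` realises the window starting at `τ`.
      obtain ⟨t, ht⟩ := arrayCoord_surjective hp (-τ)
      have h0 := h t w hwN
      rw [geom_sum_root hwN, if_neg hw1, mul_eq_zero, or_iff_left hB,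
        aeval_slab_translate hpp A t (rootM hwN), ht, neg_neg] at h0
      refine (mul_eq_zero.1 h0).resolve_left (pow_ne_zero _ ?_)
      exact hw.ne_zero hpos.ne'
  · intro h t w hw
    have hwM := rootM hw
    by_cases hw1 : w = 1
    · subst hw1
      have h1 := mul_aeval_slab_translate hp A t hwM (fiberSum_one_periodic hp hA)
      have h2 := hAB 1 hwM
      rw [geom_sum_root hw, if_pos rfl]
      rw [geom_sum_root hwM, if_pos rfl] at h2
      have h3 : (M : ℂ) = p * (M / p : ℕ) := by exact_mod_cast hMN
      refine mul_left_cancel₀ hp0 ?_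
      rw [← h3, ← h2, ← mul_assoc, h1, one_pow, one_mul]
    · rw [geom_sum_root hw, if_neg hw1]
      have h2 := hAB w hwM
      rw [geom_sum_root hwM, if_neg hw1] at h2
      by_cases hB : aeval w (maskPoly B) = 0
      · rw [hB, mul_zero]
      have hprim := IsPrimitiveRoot.orderOf w
      have hD : 0 < orderOf w := orderOf_pos_iff.2
        (isOfFinOrder_iff_pow_eq_one.2 ⟨M, NeZero.pos M, hwM⟩)
      have hDN : orderOf w ∣ M / p := orderOf_dvd_of_pow_eq_one hw
      obtain ⟨j, e, hpe, hje⟩ := Nat.exists_eq_pow_mul_and_not_dvd hD.ne' p hpp.ne_one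
      rw [hje] at hprim hD hDN
      have he : 0 < e := Nat.pos_of_mul_pos_left hD
      rw [Nat.dvd_div_iff_mul_dvd hpM, ← mul_assoc, ← pow_succ'] at hDN
      have hj : j < M.factorization p :=
        (hpp.pow_dvd_iff_le_factorization hM0).1 ((Dvd.intro _ rfl).trans hDN)
      have hdM : p ^ M.factorization p * e ∣ M :=
        Nat.Coprime.mul_dvd_of_dvd_of_dvd
          (((Nat.Prime.coprime_iff_not_dvd hpp).2 hpe).pow_left _) (Nat.ordProj_dvd M p)
          ((Dvd.intro_left _ rfl).trans hDN)
      have hdA : cyclotomic (p ^ M.factorization p * e) ℤ ∣ maskPoly A := by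
        refine (h _ (Dvd.intro _ rfl) hdM).resolve_right fun hprod => hB ?_
        rw [← cyclotomic_dvd_iff_aeval hD hprim]
        refine Dvd.dvd.trans ?_ hprod
        -- The order of `w` is `d / p ^ α` with `α = n - j`, and `α ≥ 1` as `j < n`.
        have : p ^ j * e = p ^ M.factorization p * e / p ^ (M.factorization p - j) := by
          rw [Nat.mul_div_right_comm (pow_dvd_pow p (Nat.sub_le _ _)),
            Nat.pow_div (Nat.sub_le _ _) hpp.pos, Nat.sub_sub_self hj.le]
        rw [this]
        exact Finset.dvd_prod_of_mem
          (fun α => cyclotomic (p ^ M.factorization p * e / p ^ α) ℤ)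
          (Finset.mem_Icc.2 ⟨by omega, Nat.sub_le _ _⟩)
      have h1 := mul_aeval_slab_translate hp A t hwM
        ((cyclotomic_dvd_iff_fiberSum_periodic hp A hj he hpe hprim).1 hdA)
      refine (mul_eq_zero.1 (?_ : (p : ℂ) * _ = 0)).resolve_left hp0
      rw [← mul_assoc, h1, mul_assoc, h2, mul_zero]

theorem slab_tiling_iff_divSet (hp : p ∈ M.primeFactors) {A B : Finset (ZMod M)}
    (hAB : IsTiling A B) (hA : cyclotomic (p ^ M.factorization p) ℤ ∣ maskPoly A) :
    (∀ t : ZMod M, IsTilingMod (M / p) (slab p (translateSet t A)) B) ↔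
      ∀ m : ℕ, p ^ M.factorization p ∣ m → m ∣ M → m ∈ divSet A → m / p ∉ divSet B := by
  have hpp := Nat.prime_of_mem_primeFactors hp
  have hpM := Nat.dvd_of_mem_primeFactors hp
  have hM0 := NeZero.ne M
  have hn : M.factorization p - 1 + 1 = M.factorization p :=
    Nat.sub_add_cancel (hpp.factorization_pos_of_dvd hM0 hpM)
  have hNM : M / p ∣ M := Nat.div_dvd_of_dvd hpM
  have hK : p.Coprime (M / p ^ M.factorization p) := Nat.coprime_ordCompl hpp hM0
  have hM : M = p ^ (M.factorization p - 1 + 1) * (M / p ^ M.factorization p) := by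
    rw [hn]; exact (Nat.ordProj_mul_ordCompl_eq_self M p).symm
  have hN : M / p = p ^ (M.factorization p - 1) * (M / p ^ M.factorization p) := by
    refine Nat.div_eq_of_eq_mul_right hpp.pos ?_
    rw [← mul_assoc, ← pow_succ', ← hM]
  have gcd_of_not_dvd {X : ℕ} (hX : ¬ p ^ M.factorization p ∣ X) :
      Nat.gcd X M = Nat.gcd X (M / p) := by
    rw [hN]
    conv_lhs => rw [hM]
    exact gcd_prime_pow_succ_mul_of_not_dvd hpp hK (by rwa [hn])
  have gcd_of_dvd {X : ℕ} (hX : p ^ M.factorization p ∣ X) :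
      Nat.gcd X M = p * Nat.gcd X (M / p) := by
    rw [hN]
    conv_lhs => rw [hM]
    exact gcd_prime_pow_succ_mul_of_dvd hK (by rwa [hn])
  rw [isTiling_iff_isTilingMod] at hAB
  constructor
  · rintro h m hpm - ⟨a, ha, a', ha', hm⟩ ⟨b, hb, b', hb', hmb⟩
    have hpX : p ^ M.factorization p ∣ (a - a').val :=
      hpm.trans (hm ▸ Nat.gcd_dvd_left _ _)
    have hXN : m / p = Nat.gcd (a - a').val (M / p) := by
      rw [hm, gcd_of_dvd hpX, Nat.mul_div_cancel_left _ hpp.pos]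
    have hYN : Nat.gcd (b - b').val (M / p) = m / p := by
      rw [← Nat.gcd_eq_right hNM, ← Nat.gcd_assoc, ← hmb]
      exact Nat.gcd_eq_left (hXN ▸ Nat.gcd_dvd_right _ _)
    -- Translating by `-a` moves both `a` and `a'` to coordinate `0`, hence into one slab.
    have hslab {x : ZMod M} (hx : x ∈ A) (h0 : arrayCoord p (-a + x) = 0) :
        -a + x ∈ slab p (translateSet (-a) A) :=
      Finset.mem_filter.2 ⟨Finset.mem_image_of_mem _ hx, by rw [h0, ZMod.val_zero]; omega⟩
    have h0 : arrayCoord p (a - a') = 0 := arrayCoord_eq_zero_of_dvd hpX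
    have h1 := hslab ha (by rw [neg_add_cancel, ← sub_self a, arrayCoord_sub, sub_self])
    have h2 := hslab ha' (by
      rw [arrayCoord_sub, sub_eq_zero] at h0
      rw [neg_add_eq_sub, arrayCoord_sub, h0, sub_self])
    have hbb := ((h (-a)).eq_of_gcd_eq hNM h1 h2 hb hb' (by
      rw [add_sub_add_left_eq_sub, hYN, hXN])).2
    -- With `b = b'` the gcd is `M`, so `m / p = M`, too large for a divisor of `M / p`.
    rw [hbb, sub_self, ZMod.val_zero, Nat.gcd_zero_left] at hmb
    have hle : m / p ≤ M / p := by
      rw [hXN]; exact Nat.gcd_le_right _ (NeZero.pos _)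
    exact absurd (hmb ▸ hle) (not_le.2 (Nat.div_lt_self (NeZero.pos M) hpp.one_lt))
  · intro h t
    have hcard : (slab p (translateSet t A)).card * B.card = M / p := by
      have h1 := mul_aeval_slab_translate hp A t (one_pow M) (fiberSum_one_periodic hp hA)
      simp only [aeval_maskPoly, one_pow, Finset.sum_const, nsmul_eq_mul, mul_one, one_mul] at h1
      have h2 : p * (slab p (translateSet t A)).card = A.card := by exact_mod_cast h1
      have h3 := card_mul_card_of_isTilingMod hAB
      rw [← h2, mul_assoc] at h3
      exact (Nat.div_eq_of_eq_mul_right hpp.pos h3.symm).symm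
    rw [isTilingMod_iff_representsOnce]
    refine representsOnce_of_injOn (fun a ha a' ha' b hb b' hb' e => ?_) hcard
    obtain ⟨x, hx, rfl⟩ := Finset.mem_image.1 (Finset.mem_filter.1 ha).1
    obtain ⟨x', hx', rfl⟩ := Finset.mem_image.1 (Finset.mem_filter.1 ha').1
    have hpow := pow_dvd_val_sub_of_mem_slab hp ha ha'
    rw [add_sub_add_left_eq_sub] at hpow
    have hmod : (x - x').val ≡ (b' - b).val [MOD M / p] := by
      rw [← ZMod.natCast_eq_natCast_iff, ZMod.natCast_val, ZMod.natCast_val,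
        ZMod.cast_sub hNM, ZMod.cast_sub hNM]
      rw [ZMod.cast_add hNM, ZMod.cast_add hNM] at e
      linear_combination e
    have hgcd : Nat.gcd (x - x').val (M / p) = Nat.gcd (b' - b).val (M / p) := hmod.gcd_eq
    have done (hg : Nat.gcd (x - x').val M = Nat.gcd (b' - b).val M) :
        t + x = t + x' ∧ b = b' := by
      obtain ⟨h1, h2⟩ := hAB.eq_of_gcd_eq dvd_rfl hx hx' hb' hb hg
      exact ⟨by rw [h1], h2.symm⟩
    -- If `p ^ n` divides both differences or neither, their gcds with `M` agree and Sands's theorem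
    -- applies. If only `x - x'`, (iii) is violated; if only `b' - b`, then `p ^ (n - 1) ∣ x - x'`,
    -- which in a slab forces `p ^ n ∣ x - x'`.
    by_cases hX : p ^ M.factorization p ∣ (x - x').val <;>
      by_cases hY : p ^ M.factorization p ∣ (b' - b).val
    · exact done (by rw [gcd_of_dvd hX, gcd_of_dvd hY, hgcd])
    · refine absurd ⟨b', hb', b, hb, ?_⟩ (h (Nat.gcd (x - x').val M)
        (Nat.dvd_gcd hX (Nat.ordProj_dvd M p)) (Nat.gcd_dvd_right _ _) ⟨x, hx, x', hx', rfl⟩)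
      rw [gcd_of_dvd hX, gcd_of_not_dvd hY, hgcd, Nat.mul_div_cancel_left _ hpp.pos]
    · refine absurd (hpow ?_) hX
      rw [hmod.dvd_iff (hN ▸ Dvd.intro _ rfl)]
      exact (pow_dvd_pow p (Nat.sub_le _ _)).trans hY
    · exact done (by rw [gcd_of_not_dvd hX, gcd_of_not_dvd hY, hgcd])

end SlabReduction

theorem mainTheorem4 (M : ℕ) (hM : 2 ≤ M) (p n : ℕ) (hp : p.Prime) (hpM : p ∣ M)
    (hn : n = M.factorization p) (A B : Finset (ZMod M)) (hAB : IsTiling A B)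
    (hA : Polynomial.cyclotomic (p ^ n) ℤ ∣ maskPoly A) :
    List.TFAE [
      ∀ t : ZMod M, IsTilingMod (M / p) (slab p (translateSet t A)) B,
      ∀ d : ℕ, p ^ n ∣ d → d ∣ M →
        Polynomial.cyclotomic d ℤ ∣ maskPoly A ∨
        (∏ α ∈ Finset.Icc 1 n, Polynomial.cyclotomic (d / p ^ α) ℤ) ∣ maskPoly B,
      ∀ m : ℕ, p ^ n ∣ m → m ∣ M → m ∈ divSet A → m / p ∉ divSet B] := by
  subst hn
  have : NeZero M := ⟨by omega⟩
  have : NeZero (M / p) := ⟨(Nat.div_pos (Nat.le_of_dvd (by omega) hpM) hp.pos).ne'⟩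
  have hmem : p ∈ M.primeFactors := Nat.mem_primeFactors.2 ⟨hp, hpM, by omega⟩
  tfae_have 1 ↔ 2 := slab_tiling_iff_cyclotomic hmem hAB hA
  tfae_have 1 ↔ 3 := slab_tiling_iff_divSet hmem hAB hA
  tfae_finish
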